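/- Let $n \ge 1$ be a square-free integer and let $G$ be a group of order $n$. Let $G \otimes G$ be the non-abelian tensor square of $G$ (Brown–Loday), i.e. the group generated by the symbols $g \otimes h$ ($g, h \in G$) subject to the relations $$g_1 g \otimes h = ({}^{g_1}g \otimes {}^{g_1}h)(g_1 \otimes h), \qquad g \otimes h_1 h = (g \otimes h_1)({}^{h_1}g \otimes {}^{h_1}h)$$ for all $g, g_1, h, h_1 \in G$, where ${}^{x}y = xyx^{-1}$. Then $$G \otimes G \cong \mathbb{Z}_n,$$ the cyclic group of order $n$. -/

import Mathlib

/-- The defining relators of the non-abelian tensor square of `G`, as words in the free group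
on the symbols `g ⊗ h`, i.e. on the pairs `(g, h) : G × G`. Here `G` acts on itself by
conjugation, `ᵍh = g * h * g⁻¹`. -/
inductive NonabelianTensorSquare.IsRelator (G : Type*) [Group G] : FreeGroup (G × G) → Prop
  /-- `g₁g ⊗ h = (ᵍ¹g ⊗ ᵍ¹h)(g₁ ⊗ h)` -/
  | mul_left (g₁ g h : G) : IsRelator G
      (FreeGroup.of (g₁ * g, h) *
        (FreeGroup.of (g₁ * g * g₁⁻¹, g₁ * h * g₁⁻¹) * FreeGroup.of (g₁, h))⁻¹)
  /-- `g ⊗ h₁h = (g ⊗ h₁)(ʰ¹g ⊗ ʰ¹h)` -/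
  | mul_right (g h₁ h : G) : IsRelator G
      (FreeGroup.of (g, h₁ * h) *
        (FreeGroup.of (g, h₁) * FreeGroup.of (h₁ * g * h₁⁻¹, h₁ * h * h₁⁻¹))⁻¹)

/-- The non-abelian tensor square `G ⊗ G` (Brown–Loday): the group generated by the symbols
`g ⊗ h` with `g h : G`, subject to the two families of relations above. -/
abbrev NonabelianTensorSquare (G : Type*) [Group G] : Type _ :=
  PresentedGroup {r : FreeGroup (G × G) | NonabelianTensorSquare.IsRelator G r}

/-!
For a finite group `G` all of whose Sylow subgroups are cyclic (in particular, of squarefree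
order), the derived subgroup `N` and the quotient `G ⧸ N` are cyclic of coprime orders `m` and `k`.
The tensor square `T = G ⊗ G` is shown to be cyclic of order `m * k = |G|`.

The group `G` acts on `T` by conjugating both entries of a symbol, and `g ⊗ h ↦ ⁅g, h⁆` defines a
homomorphism `κ : T → G` with image `N`. Conjugation by `t` in `T` is the action of `κ t`
(`conj_eq_act_commutatorHom`), so `ker κ` is central; as `T ⧸ ker κ ≃ N` is cyclic, `T` is abelian
(`mul_comm_of_isCyclic_commutator`), and hence `N` acts trivially on `T`. The identities
`κ t ⊗ z = t * (ᶻt)⁻¹` and `z ⊗ κ t = ᶻt * t⁻¹` then give `n ⊗ g = (g ⊗ n)⁻¹` and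
`n ⊗ n' = 1` for `n, n' ∈ N`. Choosing a generator `c` of `N` and an element `b` with `b ^ k = 1`
which generates `G` modulo `N`, it follows that `T` is generated by `b ⊗ b` and `b ⊗ c`, whose
orders divide `k` and `m`. So `T` is cyclic of order dividing `m * k`.

Conversely `κ` maps `T` onto `N`, and the multiplication of the ring `ZMod k ≃ G ⧸ N` induces a map
of `T` onto `ZMod k`; hence `m * k` divides the order of `T`.
-/

namespace NonabelianTensorSquare

open scoped commutatorElement

variable {G : Type*} [Group G]

/-- The symbol `g ⊗ h` in the non-abelian tensor square. -/
def tmul (g h : G) : NonabelianTensorSquare G := PresentedGroup.of (g, h)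

theorem mul_tmul (g₁ g h : G) :
    tmul (g₁ * g) h = tmul (g₁ * g * g₁⁻¹) (g₁ * h * g₁⁻¹) * tmul g₁ h :=
  PresentedGroup.mk_eq_mk_of_mul_inv_mem (IsRelator.mul_left g₁ g h)

theorem tmul_mul (g h₁ h : G) :
    tmul g (h₁ * h) = tmul g h₁ * tmul (h₁ * g * h₁⁻¹) (h₁ * h * h₁⁻¹) :=
  PresentedGroup.mk_eq_mk_of_mul_inv_mem (IsRelator.mul_right g h₁ h)

/-- The universal property: a function on pairs which respects both families of relations
(a "crossed pairing") extends to the tensor square. -/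
def lift {A : Type*} [Group A] (f : G → G → A)
    (hl : ∀ g₁ g h, f (g₁ * g) h = f (g₁ * g * g₁⁻¹) (g₁ * h * g₁⁻¹) * f g₁ h)
    (hr : ∀ g h₁ h, f g (h₁ * h) = f g h₁ * f (h₁ * g * h₁⁻¹) (h₁ * h * h₁⁻¹)) :
    NonabelianTensorSquare G →* A :=
  PresentedGroup.toGroup (f := fun p : G × G => f p.1 p.2) (by
    rintro _ (⟨g₁, g, h⟩ | ⟨g, h₁, h⟩)
    · simpa [mul_inv_eq_one, -mul_inv_rev] using hl g₁ g h
    · simpa [mul_inv_eq_one, -mul_inv_rev] using hr g h₁ h)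

@[simp]
theorem lift_tmul {A : Type*} [Group A] (f : G → G → A) (hl) (hr) (g h : G) :
    lift f hl hr (tmul g h) = f g h :=
  PresentedGroup.toGroup.of _

theorem mem_of_tmul_mem {H : Subgroup (NonabelianTensorSquare G)} (h : ∀ x y, tmul x y ∈ H)
    (t : NonabelianTensorSquare G) : t ∈ H :=
  PresentedGroup.generated_by _ H (fun p => h p.1 p.2) t

@[elab_as_elim]
theorem induction_on {p : NonabelianTensorSquare G → Prop} (t : NonabelianTensorSquare G)
    (tmul : ∀ x y, p (tmul x y)) (one : p 1) (mul : ∀ s t, p s → p t → p (s * t))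
    (inv : ∀ s, p s → p s⁻¹) : p t :=
  mem_of_tmul_mem
    (H := { carrier := {t | p t}, mul_mem' := mul _ _, one_mem' := one, inv_mem' := inv _ }) tmul t

theorem hom_ext {A : Type*} [Group A] {φ ψ : NonabelianTensorSquare G →* A}
    (h : ∀ x y, φ (tmul x y) = ψ (tmul x y)) : φ = ψ :=
  PresentedGroup.ext fun p => h p.1 p.2

/-! ### The action of the group and the commutator homomorphism -/

/-- The diagonal conjugation action of `g` on the tensor square: `x ⊗ y ↦ ᵍx ⊗ ᵍy`. -/
def act (g : G) : NonabelianTensorSquare G →* NonabelianTensorSquare G :=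
  lift (fun x y => tmul (g * x * g⁻¹) (g * y * g⁻¹))
    (fun g₁ x y => by
      rw [show g * (g₁ * x) * g⁻¹ = (g * g₁ * g⁻¹) * (g * x * g⁻¹) by group, mul_tmul]
      congr 2 <;> group)
    (fun x h₁ y => by
      rw [show g * (h₁ * y) * g⁻¹ = (g * h₁ * g⁻¹) * (g * y * g⁻¹) by group, tmul_mul]
      congr 2 <;> group)

@[simp]
theorem act_tmul (g x y : G) : act g (tmul x y) = tmul (g * x * g⁻¹) (g * y * g⁻¹) :=
  lift_tmul ..

theorem act_mul (g h : G) (t : NonabelianTensorSquare G) : act (g * h) t = act g (act h t) := by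
  refine DFunLike.congr_fun (f := act (g * h)) (g := (act g).comp (act h)) (hom_ext fun x y => ?_) t
  simp [mul_assoc]

theorem act_one (t : NonabelianTensorSquare G) : act (1 : G) t = t := by
  refine DFunLike.congr_fun (f := act (1 : G)) (g := MonoidHom.id _) (hom_ext fun x y => ?_) t
  simp

theorem mul_tmul_eq_act (g₁ g h : G) :
    tmul (g₁ * g) h = act g₁ (tmul g h) * tmul g₁ h := by
  rw [mul_tmul, act_tmul]

theorem tmul_mul_eq_act (g h₁ h : G) :
    tmul g (h₁ * h) = tmul g h₁ * act h₁ (tmul g h) := by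
  rw [tmul_mul, act_tmul]

@[simp]
theorem one_tmul (h : G) : tmul 1 h = 1 := by
  simpa [act_one] using mul_tmul_eq_act 1 1 h

@[simp]
theorem tmul_one (g : G) : tmul g 1 = 1 := by
  simpa [act_one] using tmul_mul_eq_act g 1 1

theorem inv_tmul (g h : G) : tmul g⁻¹ h = (act g⁻¹ (tmul g h))⁻¹ := by
  rw [eq_inv_iff_mul_eq_one, ← map_one (act g⁻¹), ← one_tmul h, ← mul_inv_cancel g,
    mul_tmul_eq_act, map_mul, ← act_mul, inv_mul_cancel, act_one]

theorem tmul_inv (g h : G) : tmul g h⁻¹ = (act h⁻¹ (tmul g h))⁻¹ := by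
  rw [eq_inv_iff_mul_eq_one, ← tmul_mul_eq_act, inv_mul_cancel, tmul_one]

/-- The homomorphism to `G` sending `g ⊗ h` to the commutator `⁅g, h⁆`. -/
def commutatorHom : NonabelianTensorSquare G →* G :=
  lift (fun x y => ⁅x, y⁆)
    (fun _ _ _ => by simp only [commutatorElement_def]; group)
    (fun _ _ _ => by simp only [commutatorElement_def]; group)

@[simp]
theorem commutatorHom_tmul (x y : G) : commutatorHom (tmul x y) = ⁅x, y⁆ := lift_tmul ..

theorem range_commutatorHom : (commutatorHom (G := G)).range = commutator G := by
  apply le_antisymm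
  · rintro _ ⟨t, rfl⟩
    induction t using induction_on with
    | tmul x y =>
      rw [commutatorHom_tmul]
      exact Subgroup.commutator_mem_commutator (Subgroup.mem_top x) (Subgroup.mem_top y)
    | one => simp
    | mul s t hs ht => simpa using mul_mem hs ht
    | inv s hs => simpa using hs
  · rw [commutator_eq_closure, Subgroup.closure_le]
    rintro _ ⟨x, y, rfl⟩
    exact ⟨tmul x y, commutatorHom_tmul x y⟩

/-- Comparison of the two ways of expanding `g x ⊗ h y`, on the left or on the right factor first. -/
theorem act_mul_tmul_comm (g h : G) (x y : G) :
    act (g * h) (tmul x y) * tmul g h = tmul g h * act (h * g) (tmul x y) := by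
  have e₁ : tmul (g * x) (h * y) = act g (tmul x h) *
      (act (g * h) (tmul x y) * tmul g h) * act h (tmul g y) := by
    rw [mul_tmul_eq_act, tmul_mul_eq_act x, tmul_mul_eq_act g, map_mul, ← act_mul]
    group
  have e₂ : tmul (g * x) (h * y) = act g (tmul x h) *
      (tmul g h * act (h * g) (tmul x y)) * act h (tmul g y) := by
    rw [tmul_mul_eq_act, mul_tmul_eq_act g x h, mul_tmul_eq_act g x y, map_mul, ← act_mul]
    group
  exact mul_left_cancel (mul_right_cancel (e₁.symm.trans e₂))

/-- Inner automorphisms of the tensor square come from the action of commutators. In particular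
the kernel of `commutatorHom` is central. -/
theorem conj_eq_act_commutatorHom (t s : NonabelianTensorSquare G) :
    t * s * t⁻¹ = act (commutatorHom t) s := by
  induction t using induction_on generalizing s with
  | tmul g h =>
    have key (s : NonabelianTensorSquare G) :
        act (g * h) s * tmul g h = tmul g h * act (h * g) s := by
      have : act (g * h) = (MulAut.conj (tmul g h)).toMonoidHom.comp (act (h * g)) :=
        hom_ext fun x y => by simp [← act_mul_tmul_comm, -act_tmul]
      rw [this]
      simp
    have h2 := key (act (h * g)⁻¹ s)
    rw [← act_mul, ← act_mul, mul_inv_cancel, act_one] at h2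
    rw [← h2, mul_inv_cancel_right, commutatorHom_tmul, commutatorElement_def]
    congr 2
    group
  | one => simp [act_one]
  | mul t₁ t₂ h₁ h₂ => rw [map_mul, act_mul, ← h₂, ← h₁]; group
  | inv t ht =>
    have := ht (t⁻¹ * s * t)
    rw [show t * (t⁻¹ * s * t) * t⁻¹ = s by group] at this
    nth_rw 2 [this]
    rw [← act_mul, map_inv, inv_mul_cancel, act_one, inv_inv]

theorem commutator_tmul (g h z : G) :
    tmul ⁅g, h⁆ z = tmul g h * (act z (tmul g h))⁻¹ := by
  -- Write `⁅g, h⁆ = g * ʰ(g⁻¹)` and expand on the left.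
  have e₁ : tmul ⁅g, h⁆ z = act (g * h * g⁻¹) (tmul g (h⁻¹ * z * h))⁻¹ * tmul g z := by
    rw [show ⁅g, h⁆ = g * (h * g⁻¹ * h⁻¹) by simp only [commutatorElement_def]; group,
      mul_tmul_eq_act]
    congr 1
    rw [show tmul (h * g⁻¹ * h⁻¹) z = act h (tmul g⁻¹ (h⁻¹ * z * h)) by
      rw [act_tmul]; congr 1; group, inv_tmul, ← map_inv, ← act_mul, ← act_mul, mul_assoc]
  -- Expand on the right, as `h⁻¹ * (z * h)`.
  have e₂ : tmul g (h⁻¹ * z * h) =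
      act h⁻¹ ((tmul g h)⁻¹ * tmul g z * act z (tmul g h)) := by
    rw [mul_assoc, tmul_mul_eq_act, tmul_inv, tmul_mul_eq_act g z h, map_mul, map_mul, map_mul,
      map_inv, mul_assoc]
  rw [e₁, e₂, ← map_inv, ← act_mul,
    show g * h * g⁻¹ * h⁻¹ = commutatorHom (tmul g h) by
      rw [commutatorHom_tmul, commutatorElement_def],
    ← conj_eq_act_commutatorHom]
  group

theorem tmul_commutator (z g h : G) :
    tmul z ⁅g, h⁆ = act z (tmul g h) * (tmul g h)⁻¹ := by
  -- Write `⁅g, h⁆ = ᵍh * h⁻¹` and expand on the right.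
  have e₁ : tmul z ⁅g, h⁆ =
      tmul z (g * h * g⁻¹) * act (commutatorHom (tmul g h)) (tmul z h)⁻¹ := by
    rw [commutatorHom_tmul, commutatorElement_def, tmul_mul_eq_act, tmul_inv, ← map_inv,
      ← act_mul]
  have e₂ : tmul z (g * h * g⁻¹) = act z (tmul g h) * tmul z h * (tmul g h)⁻¹ := by
    rw [show tmul z (g * h * g⁻¹) = act g (tmul (g⁻¹ * (z * g)) h) by
      rw [act_tmul]; congr 1; group, mul_tmul_eq_act, inv_tmul, map_mul, map_inv, ← act_mul,
      ← act_mul, mul_inv_cancel, act_one, act_one, mul_tmul_eq_act]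
  rw [e₁, e₂, ← conj_eq_act_commutatorHom]
  group

theorem commutatorHom_tmul_right (t : NonabelianTensorSquare G) (z : G) :
    tmul (commutatorHom t) z = t * (act z t)⁻¹ := by
  induction t using induction_on with
  | tmul g h => rw [commutatorHom_tmul, commutator_tmul]
  | one => simp
  | mul s t hs ht =>
    rw [map_mul, mul_tmul_eq_act, ← conj_eq_act_commutatorHom, hs, ht, map_mul]
    group
  | inv s hs =>
    rw [map_inv, inv_tmul, ← map_inv (commutatorHom (G := G)), ← map_inv (act _),
      ← conj_eq_act_commutatorHom, hs, map_inv]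
    group

theorem tmul_commutatorHom (z : G) (t : NonabelianTensorSquare G) :
    tmul z (commutatorHom t) = act z t * t⁻¹ := by
  induction t using induction_on with
  | tmul g h => rw [commutatorHom_tmul, tmul_commutator]
  | one => simp
  | mul s t hs ht =>
    rw [map_mul, tmul_mul_eq_act, ← conj_eq_act_commutatorHom, hs, ht, map_mul]
    group
  | inv s hs =>
    rw [map_inv, tmul_inv, ← map_inv (commutatorHom (G := G)), ← map_inv (act _),
      ← conj_eq_act_commutatorHom, hs, map_inv]
    group

/-! ### Groups with cyclic derived subgroup -/

/-- The tensor square is a central extension of the derived subgroup, so it is abelian when the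
derived subgroup is cyclic. -/
theorem mul_comm_of_isCyclic_commutator [IsCyclic (commutator G)] (s t : NonabelianTensorSquare G) :
    s * t = t * s := by
  have : IsCyclic (commutatorHom (G := G)).range := by rw [range_commutatorHom]; infer_instance
  refine ((commutatorHom (G := G)).rangeRestrict.isMulCommutative_of_isCyclic_of_ker_le_center
    ?_).is_comm.comm s t
  intro t ht
  have ht' : commutatorHom t = 1 := by simpa using ht
  refine Subgroup.mem_center_iff.2 fun s => ?_
  have := conj_eq_act_commutatorHom t s
  rw [ht', act_one] at this
  exact (mul_inv_eq_iff_eq_mul.1 this).symm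

theorem act_of_mem_commutator [IsCyclic (commutator G)] {n : G} (hn : n ∈ commutator G)
    (t : NonabelianTensorSquare G) : act n t = t := by
  rw [← range_commutatorHom] at hn
  obtain ⟨s, rfl⟩ := hn
  rw [← conj_eq_act_commutatorHom, mul_comm_of_isCyclic_commutator s, mul_inv_cancel_right]

theorem tmul_eq_one_of_mem_commutator [IsCyclic (commutator G)] {n n' : G}
    (hn : n ∈ commutator G) (hn' : n' ∈ commutator G) : tmul n n' = 1 := by
  rw [← range_commutatorHom] at hn'
  obtain ⟨s, rfl⟩ := hn'
  rw [tmul_commutatorHom, act_of_mem_commutator hn, mul_inv_cancel]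

/-- If `n` is the image of `t` under `commutatorHom`, then `n ⊗ g = t * (ᵍt)⁻¹` and
`g ⊗ n = ᵍt * t⁻¹`. -/
theorem tmul_swap_of_mem_commutator {n : G} (hn : n ∈ commutator G) (g : G) :
    tmul n g = (tmul g n)⁻¹ := by
  rw [← range_commutatorHom] at hn
  obtain ⟨s, rfl⟩ := hn
  rw [tmul_commutatorHom, commutatorHom_tmul_right]
  group

theorem tmul_pow_of_mem_commutator [IsCyclic (commutator G)] (g : G) {n : G}
    (hn : n ∈ commutator G) (i : ℕ) : tmul g (n ^ i) = tmul g n ^ i := by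
  induction i with
  | zero => simp
  | succ i ih => rw [pow_succ', tmul_mul_eq_act, act_of_mem_commutator hn, ih, pow_succ']

theorem act_pow_tmul_self_pow (b : G) (i j : ℕ) : act (b ^ i) (tmul b b ^ j) = tmul b b ^ j := by
  have : b ^ i * b * (b ^ i)⁻¹ = b := by rw [← pow_succ, pow_succ', mul_inv_cancel_right]
  rw [map_pow, act_tmul, this]

theorem tmul_self_pow (b : G) (j : ℕ) : tmul b (b ^ j) = tmul b b ^ j := by
  induction j with
  | zero => simp
  | succ j ih =>
    rw [pow_succ', tmul_mul_eq_act, ih, pow_succ']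
    simp

theorem pow_tmul_pow (b : G) (i j : ℕ) : tmul (b ^ i) (b ^ j) = tmul b b ^ (j * i) := by
  induction i with
  | zero => simp
  | succ i ih =>
    rw [pow_succ, mul_tmul_eq_act, tmul_self_pow, act_pow_tmul_self_pow, ih, ← pow_add]
    congr 1
    ring

/-- If `c` generates the derived subgroup and `b` generates the group modulo it, then the tensor
square is generated by `b ⊗ b` and `b ⊗ c`. -/
theorem mem_zpowers_sup [Finite G] [IsCyclic (commutator G)] {b c : G}
    (hc : Subgroup.zpowers c = commutator G)
    (hb : ∀ g : G, ∃ i : ℕ, ∃ n ∈ commutator G, g = n * b ^ i) (t : NonabelianTensorSquare G) :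
    t ∈ Subgroup.zpowers (tmul b b) ⊔ Subgroup.zpowers (tmul b c) := by
  set M := Subgroup.zpowers (tmul b c) with hM
  have hcN : c ∈ commutator G := hc ▸ Subgroup.mem_zpowers c
  have hbM {n : G} (hn : n ∈ commutator G) : tmul b n ∈ M := by
    rw [← hc, ← mem_powers_iff_mem_zpowers] at hn
    obtain ⟨j, rfl⟩ := hn
    simp only [tmul_pow_of_mem_commutator b hcN]
    exact Subgroup.npow_mem_zpowers _ j
  have hactb {s : NonabelianTensorSquare G} (hs : s ∈ M) : act b s ∈ M := by
    obtain ⟨j, rfl⟩ := hs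
    simp only [map_zpow, act_tmul, mul_inv_cancel_right]
    exact zpow_mem (hbM (Subgroup.Normal.conj_mem inferInstance c hcN b)) j
  have hact (i : ℕ) {s : NonabelianTensorSquare G} (hs : s ∈ M) : act (b ^ i) s ∈ M := by
    induction i with
    | zero => rwa [pow_zero, act_one]
    | succ i ih => rw [pow_succ', act_mul]; exact hactb ih
  have hbiM (i : ℕ) {n : G} (hn : n ∈ commutator G) : tmul (b ^ i) n ∈ M := by
    induction i with
    | zero => simp
    | succ i ih => rw [pow_succ', mul_tmul_eq_act]; exact mul_mem (hactb ih) (hbM hn)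
  have hgM (g : G) {n : G} (hn : n ∈ commutator G) : tmul g n ∈ M := by
    obtain ⟨i, n', hn', rfl⟩ := hb g
    rw [mul_tmul_eq_act, act_of_mem_commutator hn', tmul_eq_one_of_mem_commutator hn' hn, mul_one]
    exact hbiM i hn
  refine mem_of_tmul_mem (fun x y => ?_) t
  obtain ⟨i, n, hn, rfl⟩ := hb x
  obtain ⟨j, n', hn', rfl⟩ := hb y
  rw [mul_tmul_eq_act, act_of_mem_commutator hn, tmul_mul_eq_act, act_of_mem_commutator hn',
    tmul_swap_of_mem_commutator hn, pow_tmul_pow]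
  refine mul_mem (mul_mem (Subgroup.mem_sup_right (hbiM i hn')) (Subgroup.mem_sup_left ?_))
    (Subgroup.mem_sup_right (inv_mem (hgM _ hn)))
  exact Subgroup.npow_mem_zpowers _ _

/-! ### Finite groups with cyclic Sylow subgroups -/

/-- An element generating `G` modulo its derived subgroup can be chosen with order dividing the
index of the derived subgroup. -/
theorem exists_generator_mod_commutator [Finite G] [IsZGroup G] :
    ∃ b : G, b ^ (commutator G).index = 1 ∧
      ∀ g : G, ∃ i : ℕ, ∃ n ∈ commutator G, g = n * b ^ i := by
  obtain ⟨q, hq⟩ := IsCyclic.exists_monoid_generator (α := Abelianization G)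
  obtain ⟨b, rfl⟩ := (QuotientGroup.mk'_surjective (commutator G)) q
  -- The power `b ^ |G'|` has order dividing the index, and generates the same subgroup of the
  -- abelianization as `b` because `|G'|` is coprime to the order of the abelianization.
  refine ⟨b ^ Nat.card (commutator G), ?_, fun g => ?_⟩
  · rw [← pow_mul, Subgroup.card_mul_index, pow_card_eq_one']
  have hcop : (Nat.card (commutator G)).Coprime (orderOf (Abelianization.of b)) :=
    (IsZGroup.coprime_commutator_index G).coprime_dvd_right (orderOf_dvd_natCard _)
  obtain ⟨r, hr⟩ := exists_pow_eq_self_of_coprime hcop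
  obtain ⟨j, hj⟩ := hq (Abelianization.of g)
  refine ⟨r * j, g * ((b ^ Nat.card (commutator G)) ^ (r * j))⁻¹, ?_, by group⟩
  refine (Abelianization.ker_of G).le (MonoidHom.mem_ker.2 ?_)
  rw [map_mul, map_inv, map_pow, map_pow, pow_mul, hr, mul_inv_eq_one]
  exact hj.symm

/-- The tensor square surjects onto `ZMod k`, for `k` the order of the cyclic abelianization. -/
theorem index_commutator_dvd_card [IsCyclic (Abelianization G)] :
    (commutator G).index ∣ Nat.card (NonabelianTensorSquare G) := by
  set k := (commutator G).index
  let e : Multiplicative (ZMod k) ≃* Abelianization G :=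
    zmodCyclicMulEquiv (G := Abelianization G) inferInstance
  let f : G →* Multiplicative (ZMod k) := e.symm.toMonoidHom.comp Abelianization.of
  have hf : Function.Surjective f := e.symm.surjective.comp (QuotientGroup.mk'_surjective (commutator G))
  let φ : NonabelianTensorSquare G →* Multiplicative (ZMod k) :=
    lift (fun x y => Multiplicative.ofAdd ((f x).toAdd * (f y).toAdd))
      (fun g₁ g h => by simp [← ofAdd_add]; ring)
      (fun g h₁ h => by simp [← ofAdd_add]; ring)
  have hφ : Function.Surjective φ := by
    intro a
    obtain ⟨x, hx⟩ := hf a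
    obtain ⟨y, hy⟩ := hf (Multiplicative.ofAdd 1)
    exact ⟨tmul x y, by simp [φ, hx, hy]⟩
  have := Subgroup.card_dvd_of_surjective φ hφ
  rwa [Nat.card_congr Multiplicative.toAdd, Nat.card_zmod] at this

theorem card_commutator_dvd_card :
    Nat.card (commutator G) ∣ Nat.card (NonabelianTensorSquare G) := by
  rw [← range_commutatorHom]
  exact Subgroup.card_range_dvd commutatorHom

theorem isCyclic_and_card_eq [Finite G] [IsZGroup G] :
    IsCyclic (NonabelianTensorSquare G) ∧ Nat.card (NonabelianTensorSquare G) = Nat.card G := by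
  have hN : IsCyclic (commutator G) := IsZGroup.isCyclic_commutator G
  obtain ⟨b, hbk, hb⟩ := exists_generator_mod_commutator (G := G)
  obtain ⟨c, hc⟩ := (Subgroup.isCyclic_iff_exists_zpowers_eq_top (commutator G)).1 hN
  have hcN : c ∈ commutator G := hc ▸ Subgroup.mem_zpowers c
  set m := Nat.card (commutator G)
  set k := (commutator G).index
  have hmk : m.Coprime k := IsZGroup.coprime_commutator_index G
  have hcard : m * k = Nat.card G := Subgroup.card_mul_index _
  set β := tmul b b
  set γ := tmul b c
  have hβ : β ^ k = 1 := by rw [← tmul_self_pow, hbk, tmul_one]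
  have hγ : γ ^ m = 1 := by
    have : c ^ m = 1 := by
      exact congrArg Subtype.val (pow_card_eq_one' (x := (⟨c, hcN⟩ : commutator G)))
    rw [← tmul_pow_of_mem_commutator b hcN, this, tmul_one]
  have hβγ : Commute β γ := mul_comm_of_isCyclic_commutator β γ
  have hβmem : β ∈ Subgroup.zpowers (β * γ) := by
    obtain ⟨r, hr⟩ := exists_pow_eq_self_of_coprime
      (hmk.coprime_dvd_right (orderOf_dvd_of_pow_eq_one hβ))
    have : (β * γ) ^ (m * r) = β := by rw [pow_mul, hβγ.mul_pow, hγ, mul_one, hr]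
    exact Subgroup.mem_zpowers_iff.2 ⟨(m * r : ℕ), by rw [zpow_natCast, this]⟩
  have hγmem : γ ∈ Subgroup.zpowers (β * γ) := by
    simpa using mul_mem (inv_mem hβmem) (Subgroup.mem_zpowers (β * γ))
  have hgen (t : NonabelianTensorSquare G) : t ∈ Subgroup.zpowers (β * γ) :=
    sup_le ((Subgroup.zpowers_le).2 hβmem) ((Subgroup.zpowers_le).2 hγmem)
      (mem_zpowers_sup hc hb t)
  refine ⟨⟨β * γ, hgen⟩, Nat.dvd_antisymm ?_ ?_⟩
  · rw [← orderOf_eq_card_of_forall_mem_zpowers hgen, ← hcard]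
    apply orderOf_dvd_of_pow_eq_one
    rw [hβγ.mul_pow, pow_mul γ, hγ, one_pow, mul_one, mul_comm, pow_mul, hβ, one_pow]
  · rw [← hcard]
    exact hmk.mul_dvd_of_dvd_of_dvd card_commutator_dvd_card index_commutator_dvd_card

end NonabelianTensorSquare

theorem theoremA (G : Type*) [Group G] (n : ℕ) (hG : Nat.card G = n) (hn : Squarefree n) :
    Nonempty (NonabelianTensorSquare G ≃* Multiplicative (ZMod n)) := by
  subst hG
  have : Finite G := Nat.finite_of_card_ne_zero hn.ne_zero
  have : IsZGroup G := IsZGroup.of_squarefree hn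
  obtain ⟨hcyc, hcard⟩ := NonabelianTensorSquare.isCyclic_and_card_eq (G := G)
  rw [← hcard]
  exact ⟨(zmodCyclicMulEquiv hcyc).symm⟩
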